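/- Consider the following model of exploring finite connected simple graphs with an oblivious agent. Colors are natural numbers, where $0$ means "uncolored". A (zero-memory) algorithm is a function $\mathrm{move}$ that assigns to every pair $(c_0,E)$, where $c_0\in\mathbb{N}$ (the color of the current vertex) and $E\colon\mathbb{N}\to\mathbb{N}$ has finite support ($E(c)$ is the number of neighbors of color $c$), either $\mathrm{Stop}$ or a pair $(c_1,d)\in\mathbb{N}\times\mathbb{N}$ such that $E(d)>0$ and such that $c_1=c_0$ unless $c_0=0$. On a graph $G$, initially all vertices are uncolored and an adversary places the agent on a start vertex $v_0$. In each step, with the agent on a vertex $v$, the algorithm evaluates $\mathrm{move}$ at the pair $(c_0,E)$ given by the current colors of $v$ and of its neighbors. If the value is $\mathrm{Stop}$, the run ends. If it is $(c_1,d)$, then $v$ gets the color $c_1$ and the adversary moves the agent to a neighbor of $v$ of color $d$ of the adversary's choice. The algorithm successfully explores $G$ if for every adversary, after finitely many steps, every vertex has been visited by the agent, the agent is on $v_0$, and the decision is $\mathrm{Stop}$. Theorem. For every algorithm that successfully explores all finite connected simple graphs and for every integer $n\ge 1$, there are a connected simple graph $G$ with $n$ vertices and an adversary such that, in the resulting run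 on $G$, the algorithm assigns at least $n-1$ pairwise different nonzero colors to vertices of $G$. -/

import Mathlib

namespace GraphExploration

/-- The local view of the agent: the colour of the current vertex and, for every colour `c`, the
number of neighbours of colour `c`. Colour `0` means "uncoloured". -/
abbrev Env : Type := ℕ × (ℕ →₀ ℕ)

/-- A (zero-memory) algorithm. `move e = none` is the decision to stop; `move e = some (c₁, d)` is
the decision to give the current vertex the colour `c₁` and to go to a neighbour of colour `d`. -/
structure Algorithm where
  move : Env → Option (ℕ × ℕ)
  /-- The agent is never sent to a neighbour that does not exist. -/
  exists_neighbor : ∀ (c₀ : ℕ) (E : ℕ →₀ ℕ) (c₁ d : ℕ), move (c₀, E) = some (c₁, d) → 0 < E d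
  /-- A coloured vertex is never recoloured. -/
  no_recolor : ∀ (c₀ : ℕ) (E : ℕ →₀ ℕ) (c₁ d : ℕ),
    move (c₀, E) = some (c₁, d) → c₀ ≠ 0 → c₁ = c₀

/-- A configuration: the position of the agent and the current colouring of the vertices. -/
structure Config (V : Type) where
  pos : V
  col : V → ℕ

open Classical in
/-- The environment seen from the vertex `v` of `G` under the colouring `col`. -/
noncomputable def env {V : Type} [Fintype V] (G : SimpleGraph V) (col : V → ℕ) (v : V) : Env :=
  (col v,
    Finsupp.onFinset (Finset.univ.image col)
      (fun c => (Finset.univ.filter fun w => G.Adj v w ∧ col w = c).card)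
      (by
        intro c hc
        obtain ⟨w, hw⟩ := Finset.card_ne_zero.mp hc
        exact Finset.mem_image.mpr ⟨w, Finset.mem_univ w, (Finset.mem_filter.mp hw).2.2⟩))

/-- The decision of the algorithm in the configuration `s`. -/
noncomputable def Algorithm.decision (A : Algorithm) {V : Type} [Fintype V] (G : SimpleGraph V)
    (s : Config V) : Option (ℕ × ℕ) :=
  A.move (env G s.col s.pos)

open Classical in
/-- `t` can follow `s` in one step: the algorithm decides on `(c₁, d)`, the current vertex gets the
colour `c₁`, and the agent moves to some neighbour of colour `d` (the choice of this neighbour is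
made by the adversary). -/
def Algorithm.Step (A : Algorithm) {V : Type} [Fintype V] (G : SimpleGraph V)
    (s t : Config V) : Prop :=
  ∃ c₁ d : ℕ, A.decision G s = some (c₁, d) ∧
    t.col = Function.update s.col s.pos c₁ ∧ G.Adj s.pos t.pos ∧ s.col t.pos = d

/-- `s` is a run of the algorithm on `G` against some adversary. All vertices are uncoloured
initially, the start vertex `(s 0).pos` is arbitrary (it is chosen by the adversary), and each
configuration arises from the one before by a step; once the algorithm has decided to stop, the
configuration is repeated forever. -/
structure Algorithm.IsRun (A : Algorithm) {V : Type} [Fintype V] (G : SimpleGraph V)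
    (s : ℕ → Config V) : Prop where
  uncolored : ∀ v : V, (s 0).col v = 0
  next : ∀ k : ℕ, A.Step G (s k) (s (k + 1)) ∨ (A.decision G (s k) = none ∧ s (k + 1) = s k)

/-- The algorithm successfully explores `G`: for every adversary, after finitely many steps the
algorithm stops with the agent on the start vertex, all vertices having been visited. -/
def Algorithm.Explores (A : Algorithm) {V : Type} [Fintype V] (G : SimpleGraph V) : Prop :=
  ∀ s : ℕ → Config V, A.IsRun G s →
    ∃ T : ℕ, A.decision G (s T) = none ∧ (s T).pos = (s 0).pos ∧
      ∀ v : V, ∃ k ≤ T, (s k).pos = v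

/-- The algorithm successfully explores all (finite, connected, simple) graphs. -/
def Algorithm.ExploresAll (A : Algorithm) : Prop :=
  ∀ (V : Type) [Fintype V] (G : SimpleGraph V), G.Connected → A.Explores G

/-- The colours used in a run; `0` is not counted as a colour. -/
def colorsUsed {V : Type} (s : ℕ → Config V) : Set ℕ :=
  {c | c ≠ 0 ∧ ∃ (k : ℕ) (v : V), (s k).col v = c}

end GraphExploration

namespace GraphExploration

open Relation

/-! ### Reachable configurations and trapping strategies of the adversary -/

section Reach

variable {A : Algorithm} {V : Type} [Fintype V] {G : SimpleGraph V}

/-! The adversary plays on the complete graph. As long as the visited vertices are not all of it,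
stopping is forbidden, so each newly entered vertex must receive a nonzero color: otherwise the
coloring does not change and the adversary can keep the agent going forever, or stopping too early
(`Fresh.exists_color`). Once all visited vertices are colored the coloring is frozen, so the agent
must eventually be sent to a new vertex (`Fresh.exists_next`).

The heart is that the new color cannot already be present. Let `S` be the set of visited vertices.
Replace the vertices outside `S` by private copies, hung as pendant vertices on each vertex of `S`.
As long as the agent stays in `S` it sees the same environments, so the run carries over
(`Algorithm.Reach.pendantClique`). In this second graph two clique vertices `X` and `Y` of equal
color are fatal (`not_reach_same_color`). The adversary hides `Y` and its pendants, offering `X`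
instead, until the agent on `X` asks for the common color; then it moves the agent to `Y` and hides
`X` in turn. Pendants entered after their clique vertex was colored can show only one nonzero color,
so the view from `Y` depends only on how many of its pendants are uncolored. When this number has
dropped to the one at `X`, the agent on `Y` also asks for the common color, and it oscillates
between `X` and `Y` forever.

The argument needs an unvisited vertex outside `S`, so it yields `n - 1` colors and says nothing
about the last vertex. -/

/-- A step of the algorithm, together with the bookkeeping of the set of visited vertices. -/
def Algorithm.VStep (A : Algorithm) {V : Type} [Fintype V] (G : SimpleGraph V)
    (p q : Config V × Set V) : Prop :=
  A.Step G p.1 q.1 ∧ q.2 = insert q.1.pos p.2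

/-- The initial configuration with the agent on `v₀`. -/
def start {V : Type} (v₀ : V) : Config V × Set V := (⟨v₀, fun _ => 0⟩, {v₀})

/-- The pair of configuration and set of visited vertices is reached from the start vertex `v₀`
against a suitable adversary. -/
def Algorithm.Reach (A : Algorithm) {V : Type} [Fintype V] (G : SimpleGraph V) (v₀ : V)
    (p : Config V × Set V) : Prop :=
  ReflTransGen (A.VStep G) (start v₀) p

open Classical in
theorem env_snd_apply (G : SimpleGraph V) (col : V → ℕ) (v : V) (c : ℕ) :
    (env G col v).2 c = (Finset.univ.filter fun w => G.Adj v w ∧ col w = c).card := rfl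

theorem exists_adj_of_decision {s : Config V} {c d : ℕ} (h : A.decision G s = some (c, d)) :
    ∃ w, G.Adj s.pos w ∧ s.col w = d := by
  classical
  have h1 := A.exists_neighbor _ _ _ _ h
  change 0 < (env G s.col s.pos).2 d at h1
  rw [env_snd_apply, Finset.card_pos] at h1
  obtain ⟨w, hw⟩ := h1
  exact ⟨w, (Finset.mem_filter.mp hw).2⟩

theorem eq_col_of_decision {s : Config V} {c d : ℕ} (h : A.decision G s = some (c, d))
    (h0 : s.col s.pos ≠ 0) : c = s.col s.pos :=
  A.no_recolor _ _ _ _ h h0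

theorem vstep_of_decision [DecidableEq V] {s : Config V} {W : Set V} {c d : ℕ} {w : V}
    (h : A.decision G s = some (c, d)) (hw : G.Adj s.pos w) (hd : s.col w = d) :
    A.VStep G (s, W) (⟨w, Function.update s.col s.pos c⟩, insert w W) :=
  ⟨⟨c, d, h, by dsimp only; congr!, hw, hd⟩, rfl⟩

theorem vstep_of_colored {s : Config V} {W : Set V} {c d : ℕ} {w : V}
    (h : A.decision G s = some (c, d)) (hw : G.Adj s.pos w) (hd : s.col w = d)
    (hc : c = s.col s.pos) :
    A.VStep G (s, W) (⟨w, s.col⟩, insert w W) := by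
  classical
  have := vstep_of_decision (W := W) h hw hd
  rwa [hc, Function.update_eq_self] at this

/-- This is the form in which all adversary strategies are used: `Inv` need only recur after one or
more steps, and an incorrect stop also counts as a success of the adversary. -/
theorem Algorithm.Explores.not_trap (hE : A.Explores G) {v₀ : V} (Inv : Config V × Set V → Prop)
    (h : ∀ p, A.Reach G v₀ p → Inv p → (∃ q, TransGen (A.VStep G) p q ∧ Inv q) ∨
      A.decision G p.1 = none ∧ (p.1.pos ≠ v₀ ∨ p.2 ≠ Set.univ))
    {p : Config V × Set V} (hp : A.Reach G v₀ p) : ¬ Inv p := by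
  intro hi
  -- Intermediate configurations between two returns to `Inv` must be covered too, so the infinite
  -- run is built one step at a time inside this larger set.
  let Good : Config V × Set V → Prop := fun p =>
    A.Reach G v₀ p ∧ ∃ q, ReflTransGen (A.VStep G) p q ∧ Inv q
  have hnext : ∀ p, ∃ q, Good p → Good q ∧ (A.VStep G p q ∨
      ((A.decision G p.1 = none ∧ (p.1.pos ≠ v₀ ∨ p.2 ≠ Set.univ)) ∧ q = p)) := by
    intro p
    by_cases hg : Good p
    · have key : ∀ q, TransGen (A.VStep G) p q → Inv q → ∃ r, Good r ∧ A.VStep G p r := by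
        intro q hpq hq
        obtain ⟨r, hr, hrq⟩ := TransGen.head'_iff.mp hpq
        exact ⟨r, ⟨hg.1.tail hr, q, hrq, hq⟩, hr⟩
      obtain ⟨hr, q, hpq, hq⟩ := id hg
      rcases reflTransGen_iff_eq_or_transGen.mp hpq with rfl | hpq
      · rcases h q hr hq with ⟨q', hqq, hq'⟩ | hhalt
        · obtain ⟨r, h1, h2⟩ := key q' hqq hq'
          exact ⟨r, fun _ => ⟨h1, Or.inl h2⟩⟩
        · exact ⟨q, fun _ => ⟨hg, Or.inr ⟨hhalt, rfl⟩⟩⟩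
      · obtain ⟨r, h1, h2⟩ := key q hpq hq
        exact ⟨r, fun _ => ⟨h1, Or.inl h2⟩⟩
    · exact ⟨p, fun h => absurd h hg⟩
  choose nxt hnxt using hnext
  let s : ℕ → Config V × Set V := fun k => Nat.rec (start v₀) (fun _ p => nxt p) k
  have hs : ∀ k, s (k + 1) = nxt (s k) := fun k => rfl
  have hgood : ∀ k, Good (s k) := by
    intro k
    induction k with
    | zero => exact ⟨ReflTransGen.refl, p, hp, hi⟩
    | succ k ih => rw [hs]; exact (hnxt _ ih).1
  have hstep := fun k => (hnxt _ (hgood k)).2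
  simp only [← hs] at hstep
  have hvis : ∀ k i, i ≤ k → (s i).1.pos ∈ (s k).2 := by
    intro k
    induction k with
    | zero =>
      intro i hi
      obtain rfl : i = 0 := by omega
      exact Set.mem_singleton v₀
    | succ k ih =>
      intro i hi
      rcases hstep k with hv | ⟨-, hv⟩
      · rw [hv.2]
        rcases Nat.lt_or_ge i (k + 1) with hlt | hge
        · exact Set.mem_insert_of_mem _ (ih i (by omega))
        · obtain rfl : i = k + 1 := by omega
          exact Set.mem_insert _ _
      · rw [hv]
        rcases Nat.lt_or_ge i (k + 1) with hlt | hge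
        · exact ih i (by omega)
        · obtain rfl : i = k + 1 := by omega
          rw [hv]
          exact ih k le_rfl
  have hrun : A.IsRun G fun k => (s k).1 := by
    refine ⟨fun v => rfl, fun k => ?_⟩
    rcases hstep k with hv | ⟨⟨hv, -⟩, hv'⟩
    · exact Or.inl hv.1
    · exact Or.inr ⟨hv, by simp only [hv']⟩
  obtain ⟨T, hT, hpos, hall⟩ := hE _ hrun
  rcases hstep T with ⟨⟨c, d, hcd, -⟩, -⟩ | ⟨⟨-, hbad⟩, -⟩
  · exact absurd (hT.symm.trans hcd) (by simp)
  · rcases hbad with hbad | hbad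
    · exact hbad hpos
    · refine hbad (Set.eq_univ_of_forall fun v => ?_)
      obtain ⟨k, hk, hkv⟩ := hall v
      exact hkv ▸ hvis T k hk

theorem Algorithm.Explores.eq_start_of_decision_eq_none (hE : A.Explores G) {v₀ : V}
    {p : Config V × Set V} (hp : A.Reach G v₀ p) (hd : A.decision G p.1 = none) : p.1.pos = v₀ ∧ p.2 = Set.univ := by
  by_contra hcon
  refine hE.not_trap (fun q => q = p) ?_ hp rfl
  rintro q - rfl
  exact Or.inr ⟨hd, by tauto⟩

/-- A set of configurations in which the agent can be kept forever contradicts exploration. -/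
theorem Algorithm.Explores.not_cycle (hE : A.Explores G) {v₀ : V} (Inv : Config V × Set V → Prop)
    (h : ∀ p, A.Reach G v₀ p → Inv p → ∃ q, TransGen (A.VStep G) p q ∧ Inv q)
    {p : Config V × Set V} (hp : A.Reach G v₀ p) : ¬ Inv p :=
  hE.not_trap Inv (fun p h1 h2 => Or.inl (h p h1 h2)) hp

open Classical in
theorem Algorithm.Reach.col_eq_zero {v₀ : V} {p : Config V × Set V} (hp : A.Reach G v₀ p) :
    p.1.pos ∈ p.2 ∧ ∀ v, v ∉ p.2 → p.1.col v = 0 := by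
  induction hp with
  | refl => exact ⟨Set.mem_singleton v₀, fun v _ => rfl⟩
  | tail _ hst ih =>
    obtain ⟨⟨c, d, -, hcol, -, -⟩, hW⟩ := hst
    rw [hW, hcol]
    refine ⟨Set.mem_insert _ _, fun v hv => ?_⟩
    rw [Set.mem_insert_iff, not_or] at hv
    rw [Function.update_of_ne (fun h => hv.2 (by rw [h]; exact ih.1))]
    exact ih.2 v hv.2

theorem Algorithm.Reach.start_mem {v₀ : V} {p : Config V × Set V} (hp : A.Reach G v₀ p) :
    v₀ ∈ p.2 := by
  induction hp with
  | refl => exact Set.mem_singleton v₀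
  | tail _ hst ih =>
    rw [hst.2]
    exact Set.mem_insert_of_mem _ ih

theorem Algorithm.exists_continuation (A : Algorithm) (G : SimpleGraph V) (s : Config V) :
    ∃ t, A.Step G s t ∨ (A.decision G s = none ∧ t = s) := by
  classical
  rcases hd : A.decision G s with _ | ⟨c, d⟩
  · exact ⟨s, Or.inr ⟨rfl, rfl⟩⟩
  · obtain ⟨w, hw, hwd⟩ := exists_adj_of_decision hd
    exact ⟨_, Or.inl (vstep_of_decision (W := ∅) hd hw hwd).1⟩

theorem Algorithm.Reach.exists_run {v₀ : V} {p : Config V × Set V} (hp : A.Reach G v₀ p) :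
    ∃ s, A.IsRun G s ∧ ∃ k, s k = p.1 := by
  suffices H : ∃ s : ℕ → Config V, s 0 = (start v₀).1 ∧ (∃ k, s k = p.1) ∧
      ∀ k, A.Step G (s k) (s (k + 1)) ∨ (A.decision G (s k) = none ∧ s (k + 1) = s k) by
    obtain ⟨s, h0, hk, hs⟩ := H
    exact ⟨s, ⟨fun v => by rw [h0]; rfl, hs⟩, hk⟩
  unfold Algorithm.Reach at hp
  generalize start v₀ = q at hp
  induction hp using ReflTransGen.head_induction_on with
  | refl =>
    choose nxt hnxt using A.exists_continuation G
    exact ⟨fun k => Nat.rec p.1 (fun _ t => nxt t) k, rfl, ⟨0, rfl⟩, fun k => hnxt _⟩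
  | @head a b hab _ ih =>
    obtain ⟨s, h0, ⟨k, hk⟩, hs⟩ := ih
    refine ⟨fun k => Nat.casesOn k a.1 s, rfl, ⟨k + 1, hk⟩, fun k => ?_⟩
    cases k with
    | zero =>
      left
      change A.Step G a.1 (s 0)
      rw [h0]
      exact hab.1
    | succ k => exact hs k

end Reach

/-! ### Cliques with pendant vertices -/

section PendantClique

/-- The complete graph on `ι` with pendant vertices indexed by `κ` attached to each vertex. The
vertices of the clique are the pairs `(i, none)`. -/
def pendantClique (ι κ : Type) : SimpleGraph (ι × Option κ) where
  Adj p q := (p.2 = none ∧ q.2 = none ∧ p.1 ≠ q.1) ∨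
    (p.1 = q.1 ∧ (p.2 = none ∧ q.2 ≠ none ∨ p.2 ≠ none ∧ q.2 = none))
  symm := ⟨by
    rintro p q (⟨h1, h2, h3⟩ | ⟨h1, h2⟩)
    · exact Or.inl ⟨h2, h1, h3.symm⟩
    · exact Or.inr ⟨h1.symm, by tauto⟩⟩
  loopless := ⟨by
    rintro p (⟨-, -, h⟩ | ⟨-, h⟩)
    · exact h rfl
    · tauto⟩

variable {A : Algorithm} {ι κ : Type}

@[simp] theorem pendantClique_adj_none_none {i j : ι} :
    (pendantClique ι κ).Adj (i, none) (j, none) ↔ i ≠ j := by simp [pendantClique]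

@[simp] theorem pendantClique_adj_none_some {i j : ι} {k : κ} :
    (pendantClique ι κ).Adj (i, none) (j, some k) ↔ i = j := by simp [pendantClique]

@[simp] theorem pendantClique_adj_some_none {i j : ι} {k : κ} :
    (pendantClique ι κ).Adj (i, some k) (j, none) ↔ i = j := by simp [pendantClique]

@[simp] theorem pendantClique_adj_some_some {i j : ι} {k l : κ} :
    ¬ (pendantClique ι κ).Adj (i, some k) (j, some l) := by simp [pendantClique]

theorem pendantClique_connected [Nonempty ι] : (pendantClique ι κ).Connected := by
  have h1 : ∀ i j : ι, (pendantClique ι κ).Reachable (i, none) (j, none) := by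
    intro i j
    by_cases h : i = j
    · rw [h]
    · exact SimpleGraph.Adj.reachable (by simpa using h)
  have h2 : ∀ p : ι × Option κ, (pendantClique ι κ).Reachable p (p.1, none) := by
    rintro ⟨i, _ | k⟩
    · exact SimpleGraph.Reachable.refl _
    · exact SimpleGraph.Adj.reachable (by simp)
  exact ⟨fun p q => (h2 p).trans ((h1 _ _).trans (h2 q).symm)⟩

variable [Fintype ι] [Fintype κ]

open Classical in
theorem env_pendantClique_none (col : ι × Option κ → ℕ) (i : ι) (c : ℕ) :
    (env (pendantClique ι κ) col (i, none)).2 c =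
      (Finset.univ.filter fun j => i ≠ j ∧ col (j, none) = c).card +
      (Finset.univ.filter fun k => col (i, some k) = c).card := by
  rw [env_snd_apply]
  simp only [Finset.card_filter, Fintype.sum_prod_type, Fintype.sum_option, Finset.sum_add_distrib,
    pendantClique_adj_none_none, pendantClique_adj_none_some]
  congr 1
  rw [Finset.sum_eq_single i]
  · simp
  · intro j _ hj
    simp [hj.symm]
  · simp

theorem env_pendantClique_some (col : ι × Option κ → ℕ) (i : ι) (k : κ) :
    env (pendantClique ι κ) col (i, some k) =
      (col (i, some k), Finsupp.single (col (i, none)) 1) := by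
  classical
  refine Prod.ext rfl (Finsupp.ext fun c => ?_)
  rw [env_snd_apply]
  simp only [Finset.card_filter, Fintype.sum_prod_type, Fintype.sum_option,
    pendantClique_adj_some_none, pendantClique_adj_some_some, Finsupp.single_apply]
  rw [Finset.sum_eq_single i]
  · simp
  · intro j _ hj
    simp [hj.symm]
  · simp

open Classical in
theorem card_filter_ne_and_eq_congr {V : Type} [Fintype V] {col : V → ℕ} {u v : V}
    (h : col u = col v) (c : ℕ) :
    (Finset.univ.filter fun w => u ≠ w ∧ col w = c).card =
      (Finset.univ.filter fun w => v ≠ w ∧ col w = c).card := by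
  have key : ∀ u, (Finset.univ.filter fun w => u ≠ w ∧ col w = c) =
      (Finset.univ.filter fun w => col w = c).erase u := by
    intro u
    ext w
    simp [eq_comm]
  rw [key, key, Finset.card_erase_eq_ite, Finset.card_erase_eq_ite]
  simp [h]

/-- The colours a pendant vertex may have if it is attached to a vertex of colour `b` and has been
entered only after the latter was coloured. -/
def Algorithm.PendantColor (A : Algorithm) (b c : ℕ) : Prop :=
  c = 0 ∨ ∃ d, A.move (0, Finsupp.single b 1) = some (c, d)

theorem Algorithm.PendantColor.unique {b c c' : ℕ} (h : A.PendantColor b c)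
    (h' : A.PendantColor b c') (hc : c ≠ 0) (hc' : c' ≠ 0) : c = c' := by
  obtain ⟨d, hd⟩ := h.resolve_left hc
  obtain ⟨d', hd'⟩ := h'.resolve_left hc'
  rw [hd] at hd'
  simp only [Option.some.injEq, Prod.mk.injEq] at hd'
  exact hd'.1

theorem Algorithm.PendantColor.of_move {a b c d : ℕ}
    (h : A.move (a, Finsupp.single b 1) = some (c, d)) : c = a ∨ a = 0 ∧ A.PendantColor b c := by
  by_cases h0 : a = 0
  · exact Or.inr ⟨h0, Or.inr ⟨d, h0 ▸ h⟩⟩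
  · exact Or.inl (A.no_recolor _ _ _ _ h h0)

/-- The number of uncoloured pendant vertices at `(i, none)`. -/
def numUncolored (col : ι × Option κ → ℕ) (i : ι) : ℕ :=
  (Finset.univ.filter fun k => col (i, some k) = 0).card

theorem card_pendant_congr {b : ℕ} {f g : κ → ℕ} (hf : ∀ k, A.PendantColor b (f k))
    (hg : ∀ k, A.PendantColor b (g k))
    (h : (Finset.univ.filter fun k => f k = 0).card = (Finset.univ.filter fun k => g k = 0).card)
    (c : ℕ) :
    (Finset.univ.filter fun k => f k = c).card = (Finset.univ.filter fun k => g k = c).card := by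
  by_cases hc : c = 0
  · rw [hc, h]
  have hpart : ∀ e : κ → ℕ, (Finset.univ.filter fun k => e k = 0).card +
      (Finset.univ.filter fun k => ¬ e k = 0).card = Fintype.card κ :=
    fun e => Finset.card_filter_add_card_filter_not _
  by_cases hpc : A.PendantColor b c
  · have key : ∀ e : κ → ℕ, (∀ k, A.PendantColor b (e k)) →
        (Finset.univ.filter fun k => e k = c) = Finset.univ.filter fun k => ¬ e k = 0 := by
      intro e he
      ext k
      simp only [Finset.mem_filter, Finset.mem_univ, true_and]
      exact ⟨fun h => h ▸ hc, fun h => (he k).unique hpc h hc⟩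
    rw [key f hf, key g hg]
    have := hpart f
    have := hpart g
    omega
  · have key : ∀ e : κ → ℕ, (∀ k, A.PendantColor b (e k)) →
        (Finset.univ.filter fun k => e k = c) = ∅ := by
      intro e he
      ext k
      simp only [Finset.mem_filter, Finset.mem_univ, true_and, Finset.notMem_empty, iff_false]
      exact fun h => hpc (h ▸ he k)
    rw [key f hf, key g hg]

/-- Equally colored clique vertices see the same rest of the clique, and their pendants share at
most one possible nonzero color. Hence the number of uncolored pendants is the only remaining
parameter of the view. -/
theorem env_pendantClique_congr {col col' : ι × Option κ → ℕ} {g : ι → ℕ} {X Y : ι}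
    (hcol : ∀ i, col (i, none) = g i) (hcol' : ∀ i, col' (i, none) = g i) (hXY : g X = g Y)
    (hX : ∀ k, A.PendantColor (g X) (col (X, some k)))
    (hY : ∀ k, A.PendantColor (g X) (col' (Y, some k)))
    (hn : numUncolored col X = numUncolored col' Y) :
    env (pendantClique ι κ) col (X, none) = env (pendantClique ι κ) col' (Y, none) := by
  classical
  refine Prod.ext ?_ (Finsupp.ext fun c => ?_)
  · change col (X, none) = col' (Y, none)
    rw [hcol, hcol', hXY]
  · rw [env_pendantClique_none, env_pendantClique_none]
    simp only [hcol, hcol']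
    rw [card_filter_ne_and_eq_congr hXY]
    congr 1
    convert card_pendant_congr hX hY hn c

/-- The run started in the clique, so stopping on a pendant is incorrect, and the only way out leads
back. -/
theorem exists_return {r : ι} (hE : A.Explores (pendantClique ι κ)) {s : Config (ι × Option κ)}
    {W : Set (ι × Option κ)} (hp : A.Reach (pendantClique ι κ) (r, none) (s, W)) {i : ι} {k : κ}
    (hpos : s.pos = (i, some k)) :
    ∃ c col', A.VStep (pendantClique ι κ) (s, W) (⟨(i, none), col'⟩, insert (i, none) W) ∧
      col' (i, some k) = c ∧ (∀ y, y ≠ (i, some k) → col' y = s.col y) ∧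
      ∃ d, A.move (s.col (i, some k), Finsupp.single (s.col (i, none)) 1) = some (c, d) := by
  classical
  rcases hd : A.decision (pendantClique ι κ) s with _ | ⟨c, d⟩
  · have := (hE.eq_start_of_decision_eq_none hp hd).1
    rw [hpos] at this
    simp at this
  obtain ⟨⟨j, _ | l⟩, hw, hwd⟩ := exists_adj_of_decision hd
  · have hw' := hw
    rw [hpos, pendantClique_adj_some_none] at hw'
    subst hw'
    refine ⟨c, _, vstep_of_decision hd hw hwd, ?_, ?_, ?_⟩
    · rw [hpos, Function.update_self]
    · intro y hy
      rw [hpos, Function.update_of_ne hy]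
    · refine ⟨d, ?_⟩
      rwa [Algorithm.decision, hpos, env_pendantClique_some] at hd
  · rw [hpos] at hw
    exact absurd hw pendantClique_adj_some_some

theorem exists_excursion {r : ι} (hE : A.Explores (pendantClique ι κ))
    {s : Config (ι × Option κ)} {W : Set (ι × Option κ)}
    (hp : A.Reach (pendantClique ι κ) (r, none) (s, W)) {i : ι} {k : κ} (hpos : s.pos = (i, none))
    (h0 : s.col (i, none) ≠ 0) {c d : ℕ} (hd : A.decision (pendantClique ι κ) s = some (c, d))
    (hk : s.col (i, some k) = d) :
    ∃ c' col', TransGen (A.VStep (pendantClique ι κ)) (s, W)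
        (⟨(i, none), col'⟩, insert (i, none) (insert (i, some k) W)) ∧
      col' (i, some k) = c' ∧ (∀ y, y ≠ (i, some k) → col' y = s.col y) ∧
      ∃ d, A.move (s.col (i, some k), Finsupp.single (s.col (i, none)) 1) = some (c', d) := by
  have hst : A.VStep (pendantClique ι κ) (s, W) (⟨(i, some k), s.col⟩, insert (i, some k) W) := by
    refine vstep_of_colored hd ?_ hk (eq_col_of_decision hd (by rwa [hpos]))
    rw [hpos]
    simp
  obtain ⟨c', col', h1, h2, h3, h4⟩ := exists_return hE (hp.tail hst) rfl
  exact ⟨c', col', TransGen.tail (TransGen.single hst) h1, h2, h3, h4⟩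

end PendantClique

/-! ### Two clique vertices of the same color -/

section Collision

variable {A : Algorithm} {ι κ : Type} [Fintype ι] [Fintype κ]

/-- The agent is kept away from the clique vertex `Y` and its pendant vertices until it is on the
clique vertex `X` of the same colour and decides to go to a vertex of this colour. -/
theorem exists_reach_decision_same_color {r : ι} (hE : A.Explores (pendantClique ι κ))
    {g : ι → ℕ} (hg : ∀ i, g i ≠ 0) {X Y : ι} (hXY : X ≠ Y) (hgXY : g X = g Y)
    {p : Config (ι × Option κ) × Set (ι × Option κ)}
    (hp : A.Reach (pendantClique ι κ) (r, none) p)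
    (hcl : ∀ i, p.1.col (i, none) = g i)
    (hX : ∀ k, A.PendantColor (g X) (p.1.col (X, some k)))
    {i₀ : ι} (hpos : p.1.pos = (i₀, none)) (hi₀ : i₀ ≠ Y)
    (hhalt : (∃ k, (Y, some k) ∉ p.2) ∨
      ((∀ k, (X, some k) ∉ p.2) ∧ i₀ = X ∧ (∀ k, A.PendantColor (g X) (p.1.col (Y, some k))) ∧
        A.decision (pendantClique ι κ) ⟨(Y, none), p.1.col⟩ = some (g X, g X))) :
    ∃ q, A.Reach (pendantClique ι κ) (r, none) q ∧ q.1.pos = (X, none) ∧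
      (∀ i, q.1.col (i, none) = g i) ∧ (∀ k, A.PendantColor (g X) (q.1.col (X, some k))) ∧
      A.decision (pendantClique ι κ) q.1 = some (g X, g X) ∧
      (∀ k, q.1.col (Y, some k) = p.1.col (Y, some k)) ∧
      ∀ k, (Y, some k) ∈ q.2 ↔ (Y, some k) ∈ p.2 := by
  by_contra hno
  -- The last clause prevents a correct stop. Either a hidden pendant of `Y` is unvisited, or `X`
  -- has more uncolored pendants than `Y`, and one of these is unvisited because visited ones are
  -- colored. Equality of the two numbers is tolerated only on `X`, where it forces the desired
  -- decision.
  let Inv : Config (ι × Option κ) × Set (ι × Option κ) → Prop := fun q =>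
    (∀ i, q.1.col (i, none) = g i) ∧ (∀ k, A.PendantColor (g X) (q.1.col (X, some k))) ∧
    (∀ k, q.1.col (Y, some k) = p.1.col (Y, some k)) ∧
    (∀ k, (Y, some k) ∈ q.2 ↔ (Y, some k) ∈ p.2) ∧
    ∃ i, q.1.pos = (i, none) ∧ i ≠ Y ∧ ((∃ k, (Y, some k) ∉ p.2) ∨
      ((∀ k, A.PendantColor (g X) (p.1.col (Y, some k))) ∧
        A.decision (pendantClique ι κ) ⟨(Y, none), p.1.col⟩ = some (g X, g X) ∧
        (∀ k, (X, some k) ∈ q.2 → q.1.col (X, some k) ≠ 0) ∧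
        (numUncolored p.1.col Y < numUncolored q.1.col X ∨
          numUncolored p.1.col Y = numUncolored q.1.col X ∧ i = X)))
  have hInv : Inv p := by
    refine ⟨hcl, hX, fun _ => rfl, fun _ => Iff.rfl, i₀, hpos, hi₀, hhalt.imp_right ?_⟩
    rintro ⟨h1, h2, h3, h4⟩
    refine ⟨h3, h4, fun k hk => absurd hk (h1 k), ?_⟩
    have hle : numUncolored p.1.col Y ≤ numUncolored p.1.col X := by
      have hall : numUncolored p.1.col X = Fintype.card κ := by
        rw [numUncolored, Finset.filter_true_of_mem fun k _ => hp.col_eq_zero.2 _ (h1 k)]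
        rfl
      rw [hall]
      exact Finset.card_le_univ _
    rcases hle.lt_or_eq with h | h
    · exact Or.inl h
    · exact Or.inr ⟨h, h2⟩
  refine hE.not_trap Inv ?_ hp hInv
  rintro ⟨s, W⟩ hq ⟨h1, h2, h3, h4, i, h5, h6, h7⟩
  dsimp only at h1 h2 h3 h4 h5 h7
  have hnoX : i = X → A.decision (pendantClique ι κ) s ≠ some (g X, g X) := by
    rintro rfl hdec
    exact hno ⟨(s, W), hq, h5, h1, h2, hdec, h3, h4⟩
  have h8 : (∃ k, (Y, some k) ∉ p.2) ∨
      ((∀ k, A.PendantColor (g X) (p.1.col (Y, some k))) ∧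
        A.decision (pendantClique ι κ) ⟨(Y, none), p.1.col⟩ = some (g X, g X) ∧
        (∀ k, (X, some k) ∈ W → s.col (X, some k) ≠ 0) ∧
        numUncolored p.1.col Y < numUncolored s.col X) := by
    rcases h7 with h7 | ⟨hY, hdY, hvis, hlt | ⟨heq, hiX⟩⟩
    · exact Or.inl h7
    · exact Or.inr ⟨hY, hdY, hvis, hlt⟩
    · refine absurd ?_ (hnoX hiX)
      subst hiX
      rw [← hdY, Algorithm.decision, Algorithm.decision, h5]
      exact congrArg A.move (env_pendantClique_congr h1 hcl hgXY h2 hY heq.symm)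
  clear h7
  rcases hd : A.decision (pendantClique ι κ) s with _ | ⟨c, d⟩
  · refine Or.inr ⟨rfl, Or.inr fun hW => ?_⟩
    dsimp only at hW
    rcases h8 with ⟨k, hk⟩ | ⟨-, -, hvis, hlt⟩
    · exact hk ((h4 k).1 (hW ▸ Set.mem_univ _))
    · obtain ⟨k, hk⟩ := Finset.card_pos.mp (Nat.zero_lt_of_lt hlt)
      exact hvis k (hW ▸ Set.mem_univ _) (Finset.mem_filter.mp hk).2
  left
  have hc : c = g i := by
    rw [← h1 i, ← h5]
    exact eq_col_of_decision hd (by rw [h5, h1]; exact hg i)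
  have hmove : ∀ j, i ≠ j → j ≠ Y → g j = d →
      ∃ q, TransGen (A.VStep (pendantClique ι κ)) (s, W) q ∧ Inv q := by
    intro j hij hjY hjd
    refine ⟨_, TransGen.single (vstep_of_colored (w := (j, none)) hd (by rw [h5]; simpa using hij)
      ((h1 j).trans hjd) (by rw [h5, h1, hc])), h1, h2, h3, fun k => ?_, j, rfl, hjY, ?_⟩
    · simpa using h4 k
    · refine h8.imp_right ?_
      rintro ⟨hY, hdY, hvis, hlt⟩
      exact ⟨hY, hdY, fun k hk => hvis k (by simpa using hk), Or.inl hlt⟩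
  -- A request that a pendant of `i` can satisfy is answered by an excursion back to `i`, which does
  -- not touch `Y`.
  by_cases hex : ∃ k, s.col (i, some k) = d
  · obtain ⟨k, hk⟩ := hex
    obtain ⟨c', col', hst, hc', hcol', d', hmv⟩ :=
      exists_excursion hE hq h5 (by rw [h1]; exact hg i) hd hk
    have hor := Algorithm.PendantColor.of_move hmv
    have h1' : ∀ i, col' (i, none) = g i := fun j => by rw [hcol' _ (by simp), h1]
    have h3' : ∀ l, col' (Y, some l) = p.1.col (Y, some l) := fun l => by
      rw [hcol' _ (by simp [h6.symm]), h3]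
    refine ⟨_, hst, h1', ?_, h3', fun l => ?_, i, rfl, h6, ?_⟩
    · intro l
      by_cases hl : (X, some l) = (i, some k)
      · obtain rfl : X = i := congrArg Prod.fst hl
        rw [← hl] at hc' hor
        dsimp only
        rw [hc']
        rcases hor with hor | ⟨-, hor⟩
        · rw [hor]; exact h2 l
        · rwa [h1] at hor
      · dsimp only
        rw [hcol' _ hl]
        exact h2 l
    · simpa [h6.symm] using h4 l
    · refine h8.imp_right ?_
      rintro ⟨hY, hdY, hvis, hlt⟩
      refine ⟨hY, hdY, ?_⟩
      by_cases hiX : i = X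
      · subst hiX
        -- An excursion that changes no color restores the configuration and could be repeated
        -- forever. So each excursion at `X` uses up exactly one uncolored pendant, and the count
        -- cannot jump past that of `Y`.
        have hne : col' (i, some k) ≠ s.col (i, some k) := by
          intro heq
          have hcol : col' = s.col := by
            funext y
            by_cases hy : y = (i, some k)
            · rw [hy, heq]
            · exact hcol' y hy
          refine hE.not_cycle (fun q => q.1 = s) ?_ hq rfl
          rintro ⟨s', W'⟩ hq' hs'
          obtain rfl : s' = s := hs'
          obtain ⟨c₂, col₂, hst₂, hc₂, hcol₂, d₂, hmv₂⟩ :=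
            exists_excursion hE hq' h5 (by rw [h1]; exact hg i) hd hk
          rw [hmv, Option.some.injEq, Prod.mk.injEq] at hmv₂
          refine ⟨_, hst₂, ?_⟩
          have hcol' : col₂ = col' := by
            funext y
            by_cases hy : y = (i, some k)
            · rw [hy, hc₂, hc', hmv₂.1]
            · rw [hcol₂ y hy, hcol' y hy]
          rw [hcol', hcol, ← h5]
        rw [hc'] at hne
        obtain ⟨h0, hpc⟩ := hor.resolve_left hne
        have hc0 : c' ≠ 0 := by rwa [h0] at hne
        constructor
        · intro l hl
          by_cases hlk : l = k
          · dsimp only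
            rwa [hlk, hc']
          · dsimp only at hl ⊢
            rw [hcol' _ (by simpa using hlk)]
            exact hvis l (by simpa [hlk] using hl)
        · have hnum : numUncolored s.col i = numUncolored col' i + 1 := by
            classical
            have : (Finset.univ.filter fun l => s.col (i, some l) = 0) =
                insert k (Finset.univ.filter fun l => col' (i, some l) = 0) := by
              ext l
              by_cases hlk : l = k
              · simp [hlk, h0]
              · simp [hlk, hcol' (i, some l) (by simpa using hlk)]
            rw [numUncolored, numUncolored, ← Finset.card_insert_of_notMem, ← this]
            simp [hc', hc0]
          dsimp only
          rcases (Nat.lt_succ_iff.mp (hnum ▸ hlt)).lt_or_eq with h | h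
          · exact Or.inl h
          · exact Or.inr ⟨h, rfl⟩
      · have hXs : ∀ l, col' (X, some l) = s.col (X, some l) := fun l =>
          hcol' _ (by simp [Ne.symm hiX])
        refine ⟨fun l hl => ?_, Or.inl ?_⟩
        · dsimp only at hl ⊢
          rw [hXs]
          exact hvis l (by simpa [Ne.symm hiX] using hl)
        · simpa only [numUncolored, hXs] using hlt
  · obtain ⟨⟨j, _ | k⟩, hw, hwd⟩ := exists_adj_of_decision hd
    · rw [h5, pendantClique_adj_none_none] at hw
      rw [h1] at hwd
      -- A request for the color of `Y` is answered with `X`, which is available since `i ≠ X`.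
      by_cases hjY : j = Y
      · have hiX : i ≠ X := by
          intro hiX
          refine hnoX hiX (hd.trans ?_)
          rw [hc, ← hwd, hiX, hjY, hgXY]
        exact hmove X hiX hXY (by rw [hgXY, ← hjY, hwd])
      · exact hmove j hw hjY hwd
    · rw [h5, pendantClique_adj_none_some] at hw
      exact absurd ⟨k, hw ▸ hwd⟩ hex

/-- The hiding strategy is applied twice with the roles exchanged. The second phase leaves the
pendants of `X` untouched, so the decision on `X` from the first phase is still valid and both
vertices now ask for the common color. -/
theorem not_reach_same_color [Nonempty κ] {r : ι} (hE : A.Explores (pendantClique ι κ))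
    {g : ι → ℕ} (hg : ∀ i, g i ≠ 0) {X Y : ι} (hXY : X ≠ Y) (hgXY : g X = g Y)
    {p : Config (ι × Option κ) × Set (ι × Option κ)} (hcl : ∀ i, p.1.col (i, none) = g i)
    (hX : ∀ k, A.PendantColor (g X) (p.1.col (X, some k)))
    {i₀ : ι} (hpos : p.1.pos = (i₀, none)) (hi₀ : i₀ ≠ Y) (hY : ∀ k, (Y, some k) ∉ p.2) :
    ¬ A.Reach (pendantClique ι κ) (r, none) p := by
  intro hp
  obtain ⟨⟨s, W⟩, hq, h1, h2, h3, h4, h5, h6⟩ := exists_reach_decision_same_color hE hg hXY hgXY hp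
    hcl hX hpos hi₀ (Or.inl (Nonempty.elim ‹_› fun k => ⟨k, hY k⟩))
  dsimp only at h1 h2 h3 h4 h5 h6
  have hadj : (pendantClique ι κ).Adj s.pos (Y, none) := by rw [h1]; simpa using hXY
  have hY₂ : ∀ k, (Y, some k) ∉ insert (Y, none) W := fun k => by simpa [h6] using hY k
  have hq' : A.Reach (pendantClique ι κ) (r, none) (⟨(Y, none), s.col⟩, insert (Y, none) W) :=
    hq.tail (vstep_of_colored h4 hadj (by rw [h2, hgXY]) (by rw [h1, h2]))
  have hX' : A.decision (pendantClique ι κ) ⟨(X, none), s.col⟩ = some (g Y, g Y) := by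
    rw [← hgXY, ← h4, ← h1]
  obtain ⟨⟨s', W'⟩, hs', h1', h2', h3', h4', h5', -⟩ := exists_reach_decision_same_color hE hg
    hXY.symm hgXY.symm hq' h2
    (fun k => Or.inl (hq'.col_eq_zero.2 _ (hY₂ k))) rfl hXY.symm
    (Or.inr ⟨hY₂, rfl, fun k => hgXY ▸ h3 k, hX'⟩)
  dsimp only at h1' h2' h3' h4' h5'
  have hnum : numUncolored s'.col X = numUncolored s.col X := by
    simp only [numUncolored, h5']
  have hX'' : A.decision (pendantClique ι κ) ⟨(X, none), s'.col⟩ = some (g X, g X) := by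
    rw [← h4, Algorithm.decision, Algorithm.decision, h1]
    exact congrArg A.move (env_pendantClique_congr h2' h2 rfl (fun k => by rw [h5']; exact h3 k)
      h3 hnum)
  have hY'' : A.decision (pendantClique ι κ) ⟨(Y, none), s'.col⟩ = some (g Y, g Y) := by
    rw [← h4', ← h1']
  refine hE.not_cycle (fun q => q.1.col = s'.col ∧ (q.1.pos = (X, none) ∨ q.1.pos = (Y, none))) ?_
    hs' ⟨rfl, Or.inr h1'⟩
  rintro ⟨⟨pos, col⟩, W₂⟩ - ⟨hcol, hpos⟩
  obtain rfl : col = s'.col := hcol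
  rcases hpos with hpos | hpos <;> obtain rfl := hpos
  · exact ⟨_, TransGen.single (vstep_of_colored (w := (Y, none)) hX'' (by simpa using hXY)
      (by rw [h2', hgXY]) (h2' X).symm), rfl, Or.inr rfl⟩
  · exact ⟨_, TransGen.single (vstep_of_colored (w := (X, none)) hY''
      (by simpa using hXY.symm) (by rw [h2', hgXY]) (h2' Y).symm), rfl, Or.inl rfl⟩

/-- The agent cannot give the last uncoloured vertex of the clique a colour that is already present
in the clique. -/
theorem not_reach_repeated_color [Nonempty κ] {r : ι} (hE : A.Explores (pendantClique ι κ))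
    {s : Config (ι × Option κ)} {W : Set (ι × Option κ)} {u v : ι} (huv : u ≠ v)
    (hpos : s.pos = (u, none)) (hcl : ∀ i, i ≠ u → s.col (i, none) ≠ 0)
    (hW : ∀ i k, (i, some k) ∉ W) {d : ℕ}
    (hd : A.decision (pendantClique ι κ) s = some (s.col (v, none), d)) :
    ¬ A.Reach (pendantClique ι κ) (r, none) (s, W) := by
  classical
  intro hp
  obtain ⟨y, hw, hwd⟩ := exists_adj_of_decision hd
  have hst := vstep_of_decision (W := W) hd hw hwd
  rw [hpos] at hw hst
  set col := Function.update s.col (u, none) (s.col (v, none)) with hcol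
  have hcolu : col (u, none) = s.col (v, none) := Function.update_self ..
  have hcolv : col (v, none) = s.col (v, none) :=
    Function.update_of_ne (by simpa using huv.symm) ..
  have hg : ∀ i, col (i, none) ≠ 0 := by
    intro i
    by_cases hi : i = u
    · rw [hi, hcolu]; exact hcl v huv.symm
    · rw [hcol, Function.update_of_ne (by simpa using hi)]; exact hcl i hi
  have hcol0 : ∀ i k, col (i, some k) = 0 := by
    intro i k
    rw [hcol, Function.update_of_ne (by simp)]
    exact hp.col_eq_zero.2 _ (hW i k)
  -- The vertex to hide first must be free of the agent: it is `u` if the agent leaves within the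
  -- clique, and `v` if it enters a pendant of `u` and so comes back to `u`.
  rcases y with ⟨j, _ | k⟩
  · rw [pendantClique_adj_none_none] at hw
    exact not_reach_same_color hE (g := fun i => col (i, none)) hg huv.symm
      (hcolv.trans hcolu.symm) (fun _ => rfl) (fun k => Or.inl (hcol0 v k)) rfl hw.symm
      (fun k => by simpa using hW u k) (hp.tail hst)
  · rw [pendantClique_adj_none_some] at hw
    subst hw
    have hp' := hp.tail hst
    obtain ⟨c, col', hst', hc, hcol', d', hmv⟩ := exists_return hE hp' rfl
    refine not_reach_same_color hE (g := fun i => col (i, none)) hg huv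
      (hcolu.trans hcolv.symm) (fun i => hcol' _ (by simp)) (fun l => ?_) rfl huv
      (fun l => ?_) (hp'.tail hst')
    · dsimp only
      by_cases hl : l = k
      · rw [hl, hc]
        rcases Algorithm.PendantColor.of_move hmv with h | ⟨-, h⟩
        · exact Or.inl (h.trans (hcol0 u k))
        · exact h
      · rw [hcol' _ (by simpa using hl)]
        exact Or.inl (hcol0 u l)
    · simpa [huv.symm] using hW v l

end Collision

/-! ### The complete graph -/

section Complete

variable {A : Algorithm} {V : Type} [Fintype V] [DecidableEq V]

theorem env_top_congr {col : V → ℕ} {u v : V} (h : col u = col v) :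
    env (⊤ : SimpleGraph V) col u = env ⊤ col v := by
  classical
  refine Prod.ext h (Finsupp.ext fun c => ?_)
  rw [env_snd_apply, env_snd_apply]
  simp only [SimpleGraph.top_adj]
  convert card_filter_ne_and_eq_congr h c

/-- The colouring of the pendant clique on `S` that agrees with `col` on the clique and leaves the
pendant vertices uncoloured. -/
def cliqueColoring (S : Finset V) (col : V → ℕ) : {w // w ∈ S} × Option {w // w ∉ S} → ℕ
  | (w, none) => col w
  | (_, some _) => 0

/-- The uncolored neighbors outside `S` are matched by equally many private uncolored pendants. -/
theorem env_cliqueColoring {S : Finset V} {col : V → ℕ} (hcol : ∀ w, w ∉ S → col w = 0) {v : V}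
    (hv : v ∈ S) :
    env (pendantClique {w // w ∈ S} {w // w ∉ S}) (cliqueColoring S col) (⟨v, hv⟩, none) =
      env ⊤ col v := by
  classical
  refine Prod.ext rfl (Finsupp.ext fun c => ?_)
  rw [env_pendantClique_none, env_snd_apply]
  rw [Finset.card_filter, Finset.card_filter, Finset.card_filter,
    ← Fintype.sum_subtype_add_sum_subtype (fun w => w ∈ S)]
  congr 1
  · refine Finset.sum_congr (by ext; simp) fun w _ => ?_
    simp [cliqueColoring, Subtype.ext_iff]
  · refine Finset.sum_congr (by ext; simp) fun w _ => ?_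
    have : v ≠ w := fun h => w.2 (h ▸ hv)
    simp [cliqueColoring, hcol w w.2, this]
    congr

/-- A run on the complete graph that stays in `S` is also a run on the pendant clique on `S`. -/
theorem Algorithm.Reach.pendantClique {S : Finset V} {v₀ : V} {p : Config V × Set V}
    (hp : A.Reach ⊤ v₀ p) (hS : p.2 ⊆ S) (hv₀ : v₀ ∈ S) :
    ∃ (h : p.1.pos ∈ S) (W : Set ({w // w ∈ S} × Option {w // w ∉ S})),
      A.Reach (GraphExploration.pendantClique {w // w ∈ S} {w // w ∉ S}) (⟨v₀, hv₀⟩, none)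
        (⟨(⟨p.1.pos, h⟩, none), cliqueColoring S p.1.col⟩, W) ∧ ∀ i k, (i, some k) ∉ W := by
  unfold Algorithm.Reach at hp
  induction hp with
  | refl =>
    refine ⟨hv₀, {(⟨v₀, hv₀⟩, none)}, ?_, by simp⟩
    have h0 : cliqueColoring S (start v₀).1.col = fun _ => 0 := by
      funext y
      rcases y with ⟨i, _ | k⟩ <;> rfl
    rw [h0]
    exact ReflTransGen.refl
  | @tail p q hp hst ih =>
    obtain ⟨⟨c, d, hd, hcol, hadj, hwd⟩, hW⟩ := hst
    rw [hW, Set.insert_subset_iff] at hS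
    obtain ⟨h, W, hr, hWp⟩ := ih hS.2
    have hcol0 : ∀ w, w ∉ S → p.1.col w = 0 := fun w hw =>
      (Algorithm.Reach.col_eq_zero hp).2 w fun hw' => hw (hS.2 hw')
    refine ⟨hS.1, insert (⟨q.1.pos, hS.1⟩, none) W, ?_, by simpa using hWp⟩
    have hd' : A.decision (GraphExploration.pendantClique {w // w ∈ S} {w // w ∉ S})
        ⟨(⟨p.1.pos, h⟩, none), cliqueColoring S p.1.col⟩ = some (c, d) :=
      (congrArg A.move (env_cliqueColoring hcol0 h)).trans hd
    have hadj' : (GraphExploration.pendantClique {w // w ∈ S} {w // w ∉ S}).Adj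
        (⟨p.1.pos, h⟩, none) (⟨q.1.pos, hS.1⟩, none) := by simpa using hadj
    have hcc : cliqueColoring S q.1.col =
        Function.update (cliqueColoring S p.1.col) (⟨p.1.pos, h⟩, none) c := by
      funext y
      rw [hcol]
      rcases y with ⟨i, _ | k⟩
      · by_cases hi : (i : V) = p.1.pos
        · obtain rfl : i = ⟨p.1.pos, h⟩ := Subtype.ext hi
          simp [cliqueColoring]
        · have hi' : i ≠ ⟨p.1.pos, h⟩ := fun h => hi (congrArg Subtype.val h)
          simp [cliqueColoring, hi, hi']
      · simp [cliqueColoring]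
    rw [hcc]
    exact hr.tail (vstep_of_decision hd' hadj' hwd)

/-- The situation in which the vertices of `S` have pairwise different colours and the agent has
just arrived on an uncoloured vertex, having visited no vertices other than that and `S`. -/
structure Fresh (S : Finset V) (p : Config V × Set V) : Prop where
  pos_notMem : p.1.pos ∉ S
  col_ne_zero_iff : ∀ w, p.1.col w ≠ 0 ↔ w ∈ S
  injOn : Set.InjOn p.1.col S
  visited : p.2 ⊆ (insert p.1.pos S : Finset V)

theorem Fresh.exists_color (hE : A.ExploresAll) {v₀ : V} {S : Finset V} {p : Config V × Set V}
    (hp : A.Reach ⊤ v₀ p) (hF : Fresh S p) (hS : insert p.1.pos S ≠ Finset.univ) :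
    ∃ c d, A.decision ⊤ p.1 = some (c, d) ∧ c ≠ 0 ∧ ∀ v ∈ S, p.1.col v ≠ c := by
  have : Nonempty V := ⟨v₀⟩
  have hT : A.Explores (⊤ : SimpleGraph V) := hE V ⊤ SimpleGraph.connected_top
  have hbad : ∀ W : Set V, W ⊆ (insert p.1.pos S : Finset V) → W ≠ Set.univ := by
    rintro W hW rfl
    exact hS (Finset.eq_univ_of_forall fun w => hW (Set.mem_univ w))
  have hcol0 : ∀ w, p.1.col w = 0 ↔ w ∉ S := fun w => by
    rw [← hF.col_ne_zero_iff, not_not]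
  have hu := (hcol0 _).2 hF.pos_notMem
  rcases hd : A.decision ⊤ p.1 with _ | ⟨c, d⟩
  · exact absurd (hT.eq_start_of_decision_eq_none hp hd).2 (hbad _ hF.visited)
  refine ⟨c, d, rfl, ?_, ?_⟩
  · rintro rfl
    -- With no color assigned, the agent either wanders forever among uncolored vertices, which all
    -- have the same view, or goes to a colored vertex. In the latter case every later request for
    -- an uncolored vertex is answered with the same one, so nothing new is visited.
    by_cases hd0 : d = 0
    · subst hd0
      refine hT.not_cycle (fun q => q.1.col = p.1.col ∧ q.1.pos ∉ S) ?_ hp ⟨rfl, hF.pos_notMem⟩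
      rintro ⟨⟨pos, col⟩, W⟩ - ⟨rfl, hpos⟩
      have hpos0 := (hcol0 pos).2 hpos
      have hd' : A.decision ⊤ ⟨pos, p.1.col⟩ = some (0, 0) :=
        (congrArg A.move (env_top_congr (hpos0.trans hu.symm))).trans hd
      obtain ⟨w, hw, hwd⟩ := exists_adj_of_decision hd'
      exact ⟨_, TransGen.single (vstep_of_colored hd' hw hwd hpos0.symm), rfl, (hcol0 w).1 hwd⟩
    · refine hT.not_trap (fun q => q.1.col = p.1.col ∧ q.1.pos ∈ insert p.1.pos S ∧
        q.2 ⊆ (insert p.1.pos S : Finset V)) ?_ hp ⟨rfl, Finset.mem_insert_self _ _, hF.visited⟩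
      rintro ⟨⟨pos, col⟩, W⟩ - ⟨rfl, hpos, hW⟩
      dsimp only at hpos hW
      have hmove : ∀ c d, A.decision ⊤ ⟨pos, p.1.col⟩ = some (c, d) → c = p.1.col pos → ∀ w,
          pos ≠ w → p.1.col w = d → w ∈ insert p.1.pos S →
          ∃ q, TransGen (A.VStep ⊤) (⟨pos, p.1.col⟩, W) q ∧ q.1.col = p.1.col ∧
            q.1.pos ∈ insert p.1.pos S ∧ q.2 ⊆ (insert p.1.pos S : Finset V) := by
        intro c d hd hc w hw hwd hwS
        exact ⟨_, TransGen.single (vstep_of_colored hd ((SimpleGraph.top_adj _ _).2 hw) hwd hc),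
          rfl, hwS, Set.insert_subset hwS hW⟩
      rcases Finset.mem_insert.1 hpos with rfl | hpos
      · obtain ⟨w, hw, hwd⟩ := exists_adj_of_decision hd
        refine Or.inl (hmove 0 d hd hu.symm w hw hwd (Finset.mem_insert_of_mem ?_))
        exact (hF.col_ne_zero_iff w).1 (hwd ▸ hd0)
      · rcases hd' : A.decision ⊤ ⟨pos, p.1.col⟩ with _ | ⟨c', d'⟩
        · exact Or.inr ⟨rfl, Or.inr (hbad W hW)⟩
        · have hc' := eq_col_of_decision hd' ((hF.col_ne_zero_iff pos).2 hpos)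
          obtain ⟨w, hw, hwd⟩ := exists_adj_of_decision hd'
          by_cases hd0' : d' = 0
          · exact Or.inl (hmove c' d' hd' hc' p.1.pos (fun h => hF.pos_notMem (h ▸ hpos))
              (hu.trans hd0'.symm) (Finset.mem_insert_self _ _))
          · exact Or.inl (hmove c' d' hd' hc' w hw hwd (Finset.mem_insert_of_mem
              ((hF.col_ne_zero_iff w).1 (hwd ▸ hd0'))))
  · rintro v hv rfl
    -- A repeated color is refuted on the pendant clique over the visited vertices, which include
    -- the current one.
    have hv₀ : v₀ ∈ insert p.1.pos S := hF.visited hp.start_mem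
    obtain ⟨h, W, hr, hW⟩ := hp.pendantClique hF.visited hv₀
    have : Nonempty {w // w ∉ insert p.1.pos S} := by
      by_contra hne
      exact hS (Finset.eq_univ_of_forall fun w => by
        by_contra hw
        exact hne ⟨w, hw⟩)
    have : Nonempty {w // w ∈ insert p.1.pos S} := ⟨v₀, hv₀⟩
    refine not_reach_repeated_color (hE _ _ pendantClique_connected) (u := ⟨p.1.pos, h⟩)
      (v := ⟨v, Finset.mem_insert_of_mem hv⟩) ?_ rfl ?_ hW (d := d) ?_ hr
    · simp only [ne_eq, Subtype.mk.injEq]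
      exact fun h => hF.pos_notMem (h ▸ hv)
    · rintro ⟨w, hw⟩ hne
      refine (hF.col_ne_zero_iff w).2 ((Finset.mem_insert.1 hw).resolve_left fun h => hne ?_)
      exact Subtype.ext h
    · refine (congrArg A.move (env_cliqueColoring (fun w hw => ?_) h)).trans hd
      exact (hcol0 w).2 fun h => hw (Finset.mem_insert_of_mem h)

theorem Fresh.exists_next (hE : A.ExploresAll) {v₀ : V} {S : Finset V} {p : Config V × Set V}
    (hp : A.Reach ⊤ v₀ p) (hF : Fresh S p) (hS : insert p.1.pos S ≠ Finset.univ) :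
    ∃ q, A.Reach ⊤ v₀ q ∧ Fresh (insert p.1.pos S) q := by
  have : Nonempty V := ⟨v₀⟩
  have hT : A.Explores (⊤ : SimpleGraph V) := hE V ⊤ SimpleGraph.connected_top
  have hbad : ∀ W : Set V, W ⊆ (insert p.1.pos S : Finset V) → W ≠ Set.univ := by
    rintro W hW rfl
    exact hS (Finset.eq_univ_of_forall fun w => hW (Set.mem_univ w))
  obtain ⟨c, d, hd, hc0, hcS⟩ := hF.exists_color hE hp hS
  obtain ⟨w, hw, hwd⟩ := exists_adj_of_decision hd
  have hq := hp.tail (vstep_of_decision hd hw hwd)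
  set col := Function.update p.1.col p.1.pos c with hcol
  have hcolu : col p.1.pos = c := Function.update_self ..
  have hcolS : ∀ v, v ≠ p.1.pos → col v = p.1.col v := fun v hv => Function.update_of_ne hv ..
  have hne : ∀ v, col v ≠ 0 ↔ v ∈ insert p.1.pos S := by
    intro v
    by_cases hv : v = p.1.pos
    · simp [hv, hcolu, hc0]
    · rw [hcolS v hv, hF.col_ne_zero_iff, Finset.mem_insert]
      simp [hv]
  have hinj : Set.InjOn col (insert p.1.pos S : Finset V) := by
    have hS : ∀ v ∈ S, col v = p.1.col v := fun v hv =>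
      hcolS v fun h => hF.pos_notMem (h ▸ hv)
    rw [Finset.coe_insert, Set.injOn_insert (by simpa using hF.pos_notMem)]
    refine ⟨fun a ha b hb hab => ?_, ?_⟩
    · rw [hS a ha, hS b hb] at hab
      exact hF.injOn ha hb hab
    · rintro ⟨v, hv, hvc⟩
      rw [hcolu, hS v hv] at hvc
      exact hcS v hv hvc
  have hfresh : ∀ v (W : Set V), v ∉ insert p.1.pos S → W ⊆ (insert p.1.pos S : Finset V) →
      Fresh (insert p.1.pos S) (⟨v, col⟩, insert v W) := by
    intro v W hv hW
    refine ⟨hv, hne, hinj, ?_⟩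
    rw [Finset.coe_insert]
    exact Set.insert_subset_insert hW
  by_contra hno
  have hmem : ∀ v (W : Set V), W ⊆ (insert p.1.pos S : Finset V) →
      A.Reach ⊤ v₀ (⟨v, col⟩, insert v W) → v ∈ insert p.1.pos S := by
    intro v W hW hr
    by_contra hv
    exact hno ⟨_, hr, hfresh v W hv hW⟩
  have hwS := hmem w _ hF.visited hq
  -- All of `insert p.1.pos S` is now colored, so the coloring stays fixed while the agent remains
  -- there, and any stop there leaves a vertex unvisited.
  refine hT.not_trap (fun q => q.1.col = col ∧ q.1.pos ∈ insert p.1.pos S ∧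
    q.2 ⊆ (insert p.1.pos S : Finset V)) ?_ hq ⟨rfl, hwS, Set.insert_subset hwS hF.visited⟩
  rintro ⟨⟨pos, col'⟩, W⟩ hr ⟨h, hpos, hW⟩
  obtain rfl : col' = col := h
  rcases hd' : A.decision ⊤ ⟨pos, col⟩ with _ | ⟨c', d'⟩
  · exact Or.inr ⟨rfl, Or.inr (hbad W hW)⟩
  · obtain ⟨w', hw', hwd'⟩ := exists_adj_of_decision hd'
    have hst := vstep_of_colored (W := W) hd' hw' hwd' (eq_col_of_decision hd' ((hne pos).2 hpos))
    have hwS' := hmem w' W hW (hr.tail hst)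
    exact Or.inl ⟨(⟨w', col⟩, insert w' W), TransGen.single hst, rfl, hwS',
      Set.insert_subset hwS' hW⟩

theorem exists_fresh (hE : A.ExploresAll) (v₀ : V) (t : ℕ) (ht : t < Fintype.card V) :
    ∃ S p, S.card = t ∧ A.Reach ⊤ v₀ p ∧ Fresh S p := by
  induction t with
  | zero =>
    refine ⟨∅, start v₀, rfl, ReflTransGen.refl, ?_, ?_, ?_, ?_⟩ <;> simp [start]
  | succ t ih =>
    obtain ⟨S, p, hS, hp, hF⟩ := ih (by omega)
    have hcard : (insert p.1.pos S).card = t + 1 := by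
      rw [Finset.card_insert_of_notMem hF.pos_notMem, hS]
    obtain ⟨q, hq, hFq⟩ := hF.exists_next hE hp fun h => by
      rw [h, Finset.card_univ] at hcard
      omega
    exact ⟨_, q, hcard, hq, hFq⟩

end Complete

end GraphExploration

theorem mainTheorem1 (A : GraphExploration.Algorithm) (hA : A.ExploresAll) (n : ℕ) (hn : 1 ≤ n) :
    ∃ G : SimpleGraph (Fin n), G.Connected ∧
      ∃ s : ℕ → GraphExploration.Config (Fin n), A.IsRun G s ∧
        ((n - 1 : ℕ) : ℕ∞) ≤ (GraphExploration.colorsUsed s).encard := by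
  have : Nonempty (Fin n) := ⟨⟨0, hn⟩⟩
  obtain ⟨S, p, hS, hp, hF⟩ := GraphExploration.exists_fresh hA (⟨0, hn⟩ : Fin n) (n - 1)
    (by rw [Fintype.card_fin]; omega)
  obtain ⟨s, hs, k, hk⟩ := hp.exists_run
  refine ⟨⊤, SimpleGraph.connected_top, s, hs, ?_⟩
  rw [← hS, ← Set.encard_coe_eq_coe_finsetCard, ← hF.injOn.encard_image]
  refine Set.encard_le_encard ?_
  rintro _ ⟨v, hv, rfl⟩
  exact ⟨(hF.col_ne_zero_iff v).2 hv, k, v, by rw [hk]⟩
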